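/- Conventions. Let $G$ be a group with a finite family of generators $a$; words are words in the generators and their inverses, and $d_a(x,y)$ is the left-invariant word metric. A group is amenable if it carries a left-invariant finitely additive probability measure on all its subsets. For a finite presentation $\langle a\mid R\rangle$ of $G$, the area $\mathrm{Area}_R(W)$ of a word $W$ representing $1$ is the least $\ell$ such that $W$ is, in the free group, a product of $\ell$ conjugates of elements of $R^{\pm1}$. A (time-homogeneous) Markov chain $(z_n^{o})$ on $G$ (with $o\in G$ the starting point) is *tame* if (1) there is $K>0$ with $d_a(z_n^o,z_{n+1}^o)\le K$ almost surely for all $o,n$; (2) there are $A>0$, $\rho<1$ with $\mathbb P[z_n^g=h]\le A\rho^n$ for all $g,h\in G$, $n\ge0$; (3) for every $s\in G$ there are $\varepsilon_s,K_s>0$ such that for every $g\in G$ there is $k\le K_s$ with $\mathbb P[z_k^g=gs]\ge\varepsilon_s$. If $f:G\to H$ is a bijection, the push-forward chain $f_\#z$ on $H$ is the chain with $\mathbb P[(f_\#z)_n^{f(o)}=h]=\mathbb P[z_n^o=f^{-1}(h)]$. A *combing* $\alpha$ assigns to every pair $x,y\in G$ a word $\alpha(x,y)$ labelling an edge path (the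 combing line) from $x$ to $y$ in the Cayley graph; a choice of normal form $\sigma(g)$ for every $g\in G$ gives the combing $\alpha(x,y)=\sigma(x^{-1}y)$. It is *quasi-geodesic* if for some $D\ge1$ all combing lines are $(D,D)$-quasi-geodesics. If $f:G\to H$ is a bijection, a combing $\beta$ on $H$ is a *push-forward* of $\alpha$ by $f$ if, for some choice of a geodesic word between any two elements of $H$, the combing line $\beta(h,h')$ is always the image under $f$ of the path $\alpha(f^{-1}(h),f^{-1}(h'))$, the images of consecutive vertices being joined by the chosen geodesics. For a finite presentation $\langle a\mid R\rangle$ of $G$, the *random Dehn function* of $(z_n^*)$ and $\alpha$ is $$R\delta_{(G,(z_n^*),\alpha)}(n)=\sup_{o\in G}\mathbb E\Big[\mathrm{Area}_R\big(\alpha(z_0^o,z_1^o)\,\alpha(z_1^o,z_2^o)\cdots\alpha(z_{n-1}^o,z_n^o)\,\alpha(z_0^o,z_n^o)^{-1}\big)\Big].$$ For $F_1,F_2:\mathbb N\to[0,\infty)$ write $F_1\preccurlyeq F_2$ if $F_1(n)\le A\,F_2(Bn+C)+Dn+E$ for all $n$, for some constants $A,B>0$ and $C,D,E\ge0$ with $B,C$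 integers, and $F_1\asymp F_2$ if $F_1\preccurlyeq F_2$ and $F_2\preccurlyeq F_1$. Proposition. Let $G$ and $H$ be quasi-isometric finitely generated non-amenable groups, with $G$ given by a finite presentation $\langle a\mid R\rangle$ and $H$ by a finite generating family $b$. Then $H$ has a finite presentation with generators $b$. Moreover, let $(z_n^*)$ be a tame Markov chain on $G$ and $\alpha$ a quasi-geodesic combing on $G$. Then $R\delta_{(G,(z_n^*),\alpha)}$ is finite-valued, and there exist a bijective quasi-isometry $f:G\to H$ and a quasi-geodesic combing $\beta$ on $H$ which is a push-forward of $\alpha$ by $f$, such that the push-forward $(w_n^*)=f_\#(z_n^*)$ is a tame Markov chain on $H$ and, for every finite presentation $\langle b\mid R'\rangle$ of $H$, $R\delta_{(H,(w_n^*),\beta)}$ is finite-valued and $$R\delta_{(G,(z_n^*),\alpha)}\asymp R\delta_{(H,(w_n^*),\beta)}.$$ -/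

import Mathlib

open scoped ENNReal NNReal Pointwise

/-- A group is amenable if it carries a left-invariant finitely additive probability measure
defined on all of its subsets. -/
def IsAmenableGroup (G : Type*) [Group G] : Prop :=
  ∃ m : Set G → ℝ≥0∞, m Set.univ = 1 ∧
    (∀ s t : Set G, Disjoint s t → m (s ∪ t) = m s + m t) ∧
    ∀ (g : G) (s : Set G), m (g • s) = m s

/-! ### Words, word metric, presentations, area -/

/-- Words in the letters of `ι` and their formal inverses: `(i, true)` is the letter `i` and
`(i, false)` its inverse. -/
abbrev GrpWord (ι : Type*) := List (ι × Bool)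

namespace GrpWord

/-- The evaluation map, from words to the group, for the family of generators `a`. -/
def eval {ι G : Type*} [Group G] (a : ι → G) (w : GrpWord ι) : G :=
  FreeGroup.lift a (FreeGroup.mk w)

/-- The `k`-th vertex of the edge path in the Cayley graph that starts at `x` and is labelled
by `w`. -/
def vertex {ι G : Type*} [Group G] (a : ι → G) (x : G) (w : GrpWord ι) (k : ℕ) : G :=
  x * eval a (w.take k)

theorem eval_append {ι G : Type*} [Group G] (a : ι → G) (v w : GrpWord ι) :
    eval a (v ++ w) = eval a v * eval a w := by
  simp only [eval, ← FreeGroup.mul_mk, map_mul]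

theorem eval_invRev {ι G : Type*} [Group G] (a : ι → G) (w : GrpWord ι) :
    eval a (FreeGroup.invRev w) = (eval a w)⁻¹ := by
  simp only [eval, ← FreeGroup.inv_mk, map_inv]

end GrpWord

/-- The family `a` generates the group. -/
def Generates {ι G : Type*} [Group G] (a : ι → G) : Prop :=
  Subgroup.closure (Set.range a) = ⊤

/-- The (left-invariant) word metric of the generating family `a`: the least length of a word
that leads from `x` to `y` in the Cayley graph. -/
noncomputable def wordDist {ι G : Type*} [Group G] (a : ι → G) (x y : G) : ℕ :=
  sInf {n : ℕ | ∃ w : GrpWord ι, w.length = n ∧ GrpWord.eval a w = x⁻¹ * y}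

/-- `⟨a | R⟩` is a presentation of `G` with finitely many relators (the generating family `a` is
meant to be indexed by a finite type). -/
def IsFinitePresentation {ι G : Type*} [Group G] (a : ι → G) (R : Set (FreeGroup ι)) : Prop :=
  R.Finite ∧ Generates a ∧ Subgroup.normalClosure R = (FreeGroup.lift a).ker

/-- The conjugates of the relators and of their inverses in the free group. -/
def relatorConj {ι : Type*} (R : Set (FreeGroup ι)) : Set (FreeGroup ι) :=
  {g | ∃ c : FreeGroup ι, ∃ r ∈ R, g = c * r * c⁻¹ ∨ g = c * r⁻¹ * c⁻¹}

/-- The area of a null-homotopic word: the least number of conjugates of relators and inverse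
relators whose product is the word in the free group. -/
noncomputable def area {ι : Type*} (R : Set (FreeGroup ι)) (w : GrpWord ι) : ℕ :=
  sInf {n : ℕ | ∃ l : List (FreeGroup ι),
    l.length = n ∧ (∀ g ∈ l, g ∈ relatorConj R) ∧ l.prod = FreeGroup.mk w}

/-! ### Quasi-isometries -/

/-- `f` is a quasi-isometry from `G` to `H` for the word metrics of `a` and `b`. -/
def IsQuasiIsometry {ι κ G H : Type*} [Group G] [Group H] (a : ι → G) (b : κ → H)
    (f : G → H) : Prop :=
  ∃ L C : ℝ, 1 ≤ L ∧ 0 ≤ C ∧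
    (∀ x y : G, (wordDist a x y : ℝ) / L - C ≤ wordDist b (f x) (f y) ∧
      (wordDist b (f x) (f y) : ℝ) ≤ L * wordDist a x y + C) ∧
    ∀ h : H, ∃ x : G, (wordDist b (f x) h : ℝ) ≤ C

/-! ### Markov chains -/

/-- A (time-homogeneous) Markov chain on `G`, given by its transition probabilities: `z g h` is the
probability to jump from `g` to `h` in one step. -/
abbrev MarkovChain (G : Type*) := G → PMF G

namespace MarkovChain

/-- The law of the position after `n` steps of the chain started at `o`. -/
noncomputable def law {G : Type*} (z : MarkovChain G) : ℕ → G → PMF G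
  | 0, o => PMF.pure o
  | n + 1, o => (z o).bind (law z n)

/-- The joint law of the positions `[w₁, …, wₙ]` after the steps `1, …, n` of the chain started
at `w₀ = o`. -/
noncomputable def trajectory {G : Type*} (z : MarkovChain G) : ℕ → G → PMF (List G)
  | 0, _ => PMF.pure []
  | n + 1, o => (z o).bind fun g => (trajectory z n g).map fun l => g :: l

/-- The push-forward of a Markov chain by a bijection. -/
noncomputable def push {G H : Type*} (f : G ≃ H) (z : MarkovChain G) : MarkovChain H :=
  fun h => (z (f.symm h)).map f

/-- The chain pushed forward by `f` and started at `f o` is at `h` after `n` steps with the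
probability that the original chain started at `o` is at `f⁻¹ h`. -/
theorem law_push {G H : Type*} (f : G ≃ H) (z : MarkovChain G) (n : ℕ) (o : G) (h : H) :
    (z.push f).law n (f o) h = z.law n o (f.symm h) := by
  have key : ∀ (n : ℕ) (o : G), (z.push f).law n (f o) = (z.law n o).map f := by
    intro n
    induction n with
    | zero => intro o; simp [law, PMF.pure_map]
    | succ n ih =>
      intro o
      simp only [law, push, Equiv.symm_apply_apply, PMF.bind_map, PMF.map_bind]
      congr 1
      funext g
      exact ih g
  rw [key, PMF.map_apply, tsum_eq_single (f.symm h)]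
  · simp
  · intro g hg
    rw [if_neg]
    rintro rfl
    simp at hg

/-- Tame Markov chains on the group generated by `a`: bounded jumps, non-amenability (uniform
exponential decay of the transition probabilities), and irreducibility. -/
def IsTame {ι G : Type*} [Group G] (a : ι → G) (z : MarkovChain G) : Prop :=
  (∃ K : ℕ, 0 < K ∧ ∀ g h : G, z g h ≠ 0 → wordDist a g h ≤ K) ∧
  (∃ A ρ : ℝ, 0 < A ∧ ρ < 1 ∧ ∀ (g h : G) (n : ℕ), (z.law n g h).toReal ≤ A * ρ ^ n) ∧
  ∀ s : G, ∃ (ε : ℝ) (K : ℕ), 0 < ε ∧ 0 < K ∧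
    ∀ g : G, ∃ k ≤ K, ε ≤ (z.law k g (g * s)).toReal

end MarkovChain

/-! ### Combings -/

/-- A combing: for every pair `x, y` of elements of the group, a word that labels an edge path
from `x` to `y` in the Cayley graph. A choice `σ` of a normal form for every group element gives
the combing `fun x y => σ (x⁻¹ * y)`. -/
structure GrpCombing {ι G : Type*} [Group G] (a : ι → G) where
  /-- the label of the combing line from `x` to `y` -/
  word : G → G → GrpWord ι
  eval_word : ∀ x y : G, GrpWord.eval a (word x y) = x⁻¹ * y

namespace GrpCombing

/-- All combing lines are `(D, D)`-quasi-geodesics, for one constant `D ≥ 1`. -/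
def IsQuasiGeodesic {ι G : Type*} [Group G] {a : ι → G} (α : GrpCombing a) : Prop :=
  ∃ D : ℝ, 1 ≤ D ∧ ∀ (x y : G) (i j : ℕ), i ≤ j → j ≤ (α.word x y).length →
    ((j : ℝ) - i) / D - D ≤
        wordDist a (GrpWord.vertex a x (α.word x y) i) (GrpWord.vertex a x (α.word x y) j) ∧
      (wordDist a (GrpWord.vertex a x (α.word x y) i) (GrpWord.vertex a x (α.word x y) j) : ℝ) ≤
        D * ((j : ℝ) - i) + D

/-- The concatenation of the combing lines from `x` to the first element of the list, from there
to the second element, and so on. -/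
def chainWord {ι G : Type*} [Group G] {a : ι → G} (α : GrpCombing a) : G → List G → GrpWord ι
  | _, [] => []
  | x, y :: l => α.word x y ++ chainWord α y l

/-- The label of the loop at `x` that runs through the elements of the list `l` along combing
lines, and comes back from the last element to `x` along the reverse of the combing line from
`x` to it. -/
def loopWord {ι G : Type*} [Group G] {a : ι → G} (α : GrpCombing a) (x : G) (l : List G) :
    GrpWord ι :=
  α.chainWord x l ++ FreeGroup.invRev (α.word x (l.getLastD x))

theorem eval_chainWord {ι G : Type*} [Group G] {a : ι → G} (α : GrpCombing a) (l : List G) :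
    ∀ x : G, GrpWord.eval a (α.chainWord x l) = x⁻¹ * l.getLastD x := by
  induction l with
  | nil => intro x; simp [chainWord, GrpWord.eval, FreeGroup.lift_mk]
  | cons y l ih =>
    intro x
    rw [chainWord, GrpWord.eval_append, ih, α.eval_word, List.getLastD_cons]
    group

/-- The loop word is null-homotopic, so that its area is defined. -/
theorem eval_loopWord {ι G : Type*} [Group G] {a : ι → G} (α : GrpCombing a) (x : G)
    (l : List G) : GrpWord.eval a (α.loopWord x l) = 1 := by
  rw [loopWord, GrpWord.eval_append, GrpWord.eval_invRev, eval_chainWord, α.eval_word,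
    mul_inv_cancel]

/-- The image under `f` of the edge path that starts at `x` and is labelled by a word: every edge
from `g` to `g'` is replaced by the path labelled `u (f g) (f g')`. -/
def imageWord {ι κ G H : Type*} [Group G] [Group H] (a : ι → G) {b : κ → H} (f : G → H)
    (u : GrpCombing b) : G → GrpWord ι → GrpWord κ
  | _, [] => []
  | x, s :: w =>
      u.word (f x) (f (x * GrpWord.eval a [s])) ++ imageWord a f u (x * GrpWord.eval a [s]) w

/-- `β` is a push-forward of `α` by the bijection `f`: the combing line of `β` from `h` to `h'` is
the image under `f` of the combing line of `α` from `f⁻¹ h` to `f⁻¹ h'`, where the images of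
adjacent vertices are joined by geodesics. -/
def IsPushForward {ι κ G H : Type*} [Group G] [Group H] {a : ι → G} {b : κ → H} (f : G ≃ H)
    (α : GrpCombing a) (β : GrpCombing b) : Prop :=
  ∃ u : GrpCombing b, (∀ h h' : H, (u.word h h').length = wordDist b h h') ∧
    ∀ h h' : H, β.word h h' =
      imageWord a f u (f.symm h) (α.word (f.symm h) (f.symm h'))

end GrpCombing

/-! ### The random Dehn function -/

/-- The random Dehn function of the presentation with relators `R` with respect to the Markov chain
`z` and the combing `α`: the supremum over the starting points `o` of the expected area of the
loop that the first `n` steps of the chain form with the combing line between their endpoints. -/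
noncomputable def randomDehn {ι G : Type*} [Group G] {a : ι → G} (R : Set (FreeGroup ι))
    (z : MarkovChain G) (α : GrpCombing a) (n : ℕ) : ℝ≥0∞ :=
  ⨆ o : G, ∑' l : List G, z.trajectory n o l * (area R (α.loopWord o l) : ℝ≥0∞)

/-- The asymptotic comparison `f ≼ g` of growth functions. -/
def AsympLE (f g : ℕ → ℝ≥0∞) : Prop :=
  ∃ (A D E : ℝ≥0) (B C : ℕ), 0 < A ∧ 0 < B ∧ ∀ n : ℕ, f n ≤ A * g (B * n + C) + D * n + E

/-- The asymptotic equivalence of growth functions. -/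
def AsympEquiv (f g : ℕ → ℝ≥0∞) : Prop :=
  AsympLE f g ∧ AsympLE g f

/-! Non-amenability serves to replace the quasi-isometry by a bijective one. Without Følner sets
some finite `S` satisfies `p * |F| ≤ |S * F|` for all finite `F`. Hall's marriage theorem then moves
a map with bounded fibres a bounded distance to an injective one (`exists_injective_near`). Doing
this in both directions and applying Schroeder–Bernstein gives `exists_equiv_of_isQuasiIsometry`.

For a bijection `f`, trajectories of the two chains correspond with equal probabilities, so areas
can be compared loop by loop. Edges are sent to geodesics, chosen symmetrically so that the image of
a path makes sense in the free group (`imagePath`). Relators become null-homotopic words of bounded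
length, hence fillings are carried over with area multiplied by a constant (`AreaLE.imagePath`).
Carrying a loop over and back changes it by a homotopy of area linear in its length
(`areaLE_mul_imageWord_imageWord_inv`). Bounded jumps and quasi-geodesic combing lines make that
length linear in the number of steps, an error that `AsympLE` absorbs. The same round trip shows
that `H` is finitely presented. -/

/-! ### Expansion in non-amenable groups -/

/-- Otherwise every multiplication by `S` expands by `1 + 1/n`; after `n` of them Bernoulli's
inequality gives a factor of at least `2`, against `h (S ^ n)`. -/
theorem exists_card_mul_lt_of_not_doubling {G : Type*} [Group G] [DecidableEq G]
    (h : ∀ S : Finset G, ∃ F : Finset G, (S * F).card < 2 * F.card) (S : Finset G) (n : ℕ)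
    (hn : 0 < n) : ∃ F : Finset G, n * (S * F).card < (n + 1) * F.card := by
  by_contra! hS
  have key : ∀ (k : ℕ) (F : Finset G), (n + 1) ^ k * F.card ≤ n ^ k * (S ^ k * F).card := by
    intro k F
    induction k with
    | zero => simp
    | succ k ih =>
      calc (n + 1) ^ (k + 1) * F.card = (n + 1) * ((n + 1) ^ k * F.card) := by ring
        _ ≤ (n + 1) * (n ^ k * (S ^ k * F).card) := by gcongr
        _ = n ^ k * ((n + 1) * (S ^ k * F).card) := by ring
        _ ≤ n ^ k * (n * (S * (S ^ k * F)).card) := by exact Nat.mul_le_mul_left _ (hS _)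
        _ = n ^ (k + 1) * (S ^ (k + 1) * F).card := by rw [pow_succ' S, mul_assoc]; ring
  obtain ⟨F, hF⟩ := h (S ^ n)
  have h2 : 2 * n ^ n ≤ (n + 1) ^ n := by
    have hb : (1 : ℝ) + n * (1 / n) ≤ (1 + 1 / n) ^ n :=
      one_add_mul_le_pow (le_trans (by norm_num) (by positivity : (0 : ℝ) ≤ 1 / n)) n
    have hn' : (n : ℝ) ≠ 0 := by positivity
    rw [mul_one_div_cancel hn', show (1 : ℝ) + 1 / n = (n + 1) / n by field_simp, div_pow,
      le_div_iff₀ (by positivity)] at hb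
    have hb' : (2 : ℝ) * n ^ n ≤ (n + 1) ^ n := by linarith
    exact_mod_cast hb'
  have h3 := key n F
  have h4 : 2 * n ^ n * F.card ≤ n ^ n * (S ^ n * F).card := (by gcongr : _ ≤ _).trans h3
  have h5 : n ^ n * (S ^ n * F).card < n ^ n * (2 * F.card) := by gcongr
  have h6 : n ^ n * (2 * F.card) = 2 * n ^ n * F.card := by ring
  omega

/-- If no `S` doubles, the almost invariant sets for all pairs `(S, n)` form a Følner net for the
counting measure, whose limit is an invariant mean. -/
theorem exists_doubling_of_not_amenable {G : Type*} [Group G] [DecidableEq G]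
    (hG : ¬ IsAmenableGroup G) :
    ∃ S : Finset G, ∀ F : Finset G, 2 * F.card ≤ (S * F).card := by
  by_contra! h
  apply hG
  have h1 : ∀ i : Finset G × ℕ, ∃ F : Finset G,
      (i.2 + 1) * (insert 1 i.1 * F).card < (i.2 + 1 + 1) * F.card := fun i =>
    exists_card_mul_lt_of_not_doubling h _ _ (Nat.succ_pos _)
  choose F hF using h1
  have hpos : ∀ i, 0 < (F i).card := fun i => by
    by_contra h0
    have := hF i
    simp_all
  -- With the discrete σ-algebra the mean is additive on all subsets.
  let _ : MeasurableSpace G := ⊤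
  have : MeasureTheory.SMulInvariantMeasure G G (MeasureTheory.Measure.count : MeasureTheory.Measure G) :=
    ⟨fun c s _ => by
      rw [Set.preimage_smul]
      exact MeasureTheory.Measure.count_injective_image (MulAction.injective c⁻¹) s⟩
  have hfo : IsFoelner G (MeasureTheory.Measure.count : MeasureTheory.Measure G)
      Filter.atTop (fun i => (F i : Set G)) := by
    refine ⟨.of_forall fun _ => trivial, .of_forall fun i => ?_, .of_forall fun i => ?_,
      fun g => ?_⟩
    · rw [MeasureTheory.Measure.count_apply_finset]
      exact_mod_cast (hpos i).ne'
    · rw [MeasureTheory.Measure.count_apply_finset]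
      exact ENNReal.natCast_ne_top _
    · have hlim : Filter.Tendsto (fun i : Finset G × ℕ => (2 : ℝ≥0∞) * ((i.2 : ℝ≥0∞))⁻¹)
          Filter.atTop (nhds 0) := by
        have h0 : Filter.Tendsto (fun n : ℕ => (2 : ℝ≥0∞) * ((n : ℝ≥0∞))⁻¹)
            Filter.atTop (nhds (2 * 0)) :=
          ENNReal.Tendsto.const_mul ENNReal.tendsto_inv_nat_nhds_zero (Or.inr (by simp))
        rw [mul_zero] at h0
        refine h0.comp ?_
        rw [← Filter.prod_atTop_atTop_eq]
        exact Filter.tendsto_snd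
      refine tendsto_of_tendsto_of_tendsto_of_le_of_le' tendsto_const_nhds hlim
        (.of_forall fun _ => zero_le) ?_
      filter_upwards [Filter.eventually_ge_atTop (({g} : Finset G), 1)] with i hi
      have hg : g ∈ i.1 := hi.1 (Finset.mem_singleton_self g)
      have hi1 : 1 ≤ i.2 := hi.2
      have hcoe : symmDiff (g • (F i : Set G)) (F i : Set G) =
          (((g • F i) \ F i ∪ F i \ (g • F i) : Finset G) : Set G) := by
        push_cast
        rfl
      rw [hcoe, MeasureTheory.Measure.count_apply_finset,
        MeasureTheory.Measure.count_apply_finset]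
      -- The inserted `1` puts `F i` itself into the product, so the symmetric difference has at
      -- most `2 * (|insert 1 i.1 * F i| - |F i|)` elements.
      have hsub : g • F i ∪ F i ⊆ insert 1 i.1 * F i := by
        intro x hx
        rcases Finset.mem_union.1 hx with hx | hx
        · obtain ⟨y, hy, rfl⟩ := Finset.mem_smul_finset.1 hx
          exact Finset.mul_mem_mul (Finset.mem_insert_of_mem hg) hy
        · simpa using Finset.mul_mem_mul (Finset.mem_insert_self 1 i.1) hx
      have hc := Finset.card_le_card hsub
      have e1 : (g • F i).card = (F i).card := Finset.card_smul_finset g (F i)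
      have e2 := Finset.card_sdiff_add_card (g • F i) (F i)
      have e3 := Finset.card_sdiff_add_card (F i) (g • F i)
      rw [Finset.union_comm] at e3
      have e4 := Finset.card_union_le ((g • F i) \ F i) (F i \ (g • F i))
      have e5 := hF i
      have e6 : i.2 * ((g • F i) \ F i ∪ F i \ (g • F i)).card ≤ 2 * (F i).card := by
        have : ((g • F i) \ F i ∪ F i \ (g • F i)).card + 2 * (F i).card
          ≤ 2 * (insert 1 i.1 * F i).card := by omega
        nlinarith
      rw [ENNReal.div_le_iff (by exact_mod_cast (hpos i).ne') (ENNReal.natCast_ne_top _)]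
      have hi0 : (i.2 : ℝ≥0∞) ≠ 0 := by exact_mod_cast (by omega : i.2 ≠ 0)
      rw [mul_right_comm, ← div_eq_mul_inv, ENNReal.le_div_iff_mul_le (Or.inl hi0)
        (Or.inl (ENNReal.natCast_ne_top _)), mul_comm]
      exact_mod_cast e6
  obtain ⟨m, hm1, hm2, hm3⟩ := hfo.amenable
  exact ⟨m, hm1, fun s t hst => hm2 s t trivial hst, hm3⟩

theorem exists_expanding_of_not_amenable {G : Type*} [Group G] [DecidableEq G]
    (hG : ¬ IsAmenableGroup G) (p : ℕ) :
    ∃ S : Finset G, ∀ F : Finset G, p * F.card ≤ (S * F).card := by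
  obtain ⟨S, hS⟩ := exists_doubling_of_not_amenable hG
  have key : ∀ (k : ℕ) (F : Finset G), 2 ^ k * F.card ≤ (S ^ k * F).card := by
    intro k F
    induction k with
    | zero => simp
    | succ k ih =>
      have := hS (S ^ k * F)
      rw [pow_succ' S, mul_assoc, pow_succ]
      linarith
  exact ⟨S ^ p, fun F => le_trans (by gcongr; exact Nat.lt_two_pow_self.le) (key p F)⟩

/-- A map with uniformly bounded fibres into a non-amenable group is within bounded distance of an
injective map. -/
theorem exists_injective_near {X G : Type*} [Group G] [DecidableEq G] (hG : ¬ IsAmenableGroup G)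
    (q : X → G) (p : ℕ) (hp : ∀ F : Finset X, F.card ≤ p * (F.image q).card) :
    ∃ T : Finset G, ∃ f : X → G, Function.Injective f ∧ ∀ x, (q x)⁻¹ * f x ∈ T := by
  obtain ⟨S, hS⟩ := exists_expanding_of_not_amenable hG p
  have hall : ∀ F : Finset X,
      F.card ≤ (F.biUnion fun x => S⁻¹.image fun s => q x * s).card := by
    intro F
    have hbi : (F.biUnion fun x => S⁻¹.image fun s => q x * s) = F.image q * S⁻¹ := by
      ext y
      simp only [Finset.mem_biUnion, Finset.mem_image, Finset.mem_mul, exists_exists_and_eq_and]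
    -- Expansion holds for left products, whereas displacement in a left-invariant metric is right
    -- multiplication; inversion exchanges the two.
    have h1 := hS (F.image q)⁻¹
    rw [Finset.card_inv, ← Finset.card_inv (S * _), mul_inv_rev, inv_inv] at h1
    rw [hbi]
    exact (hp F).trans h1
  obtain ⟨f, hf, hft⟩ := (Finset.all_card_le_biUnion_card_iff_exists_injective _).1 hall
  refine ⟨S⁻¹, f, hf, fun x => ?_⟩
  obtain ⟨s, hs, hsx⟩ := Finset.mem_image.1 (hft x)
  rw [← hsx, inv_mul_cancel_left]
  exact hs

theorem card_le_mul_card_image_of_fiber {X G : Type*} [Group X] [DecidableEq X] [DecidableEq G]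
    (q : X → G) (B : Finset X) (hq : ∀ x y, q x = q y → x⁻¹ * y ∈ B) (F : Finset X) :
    F.card ≤ B.card * (F.image q).card := by
  refine Finset.card_le_mul_card_image F _ fun g hg => ?_
  obtain ⟨x, -, rfl⟩ := Finset.mem_image.1 hg
  refine Finset.card_le_card_of_injOn (fun y => x⁻¹ * y) (fun y hy => ?_)
    (mul_right_injective x⁻¹).injOn
  exact hq x y (Finset.mem_filter.1 hy).2.symm


/-! ### The word metric -/

section WordMetric

variable {ι G : Type*} [Group G] {a : ι → G}

theorem GrpWord.eval_nil : GrpWord.eval a [] = 1 := by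
  simp [GrpWord.eval, FreeGroup.lift_mk]

theorem wordDist_le_length {x y : G} {w : GrpWord ι} (h : GrpWord.eval a w = x⁻¹ * y) :
    wordDist a x y ≤ w.length :=
  Nat.sInf_le ⟨w, rfl, h⟩

theorem Generates.exists_eval_eq (ha : Generates a) (g : G) :
    ∃ w : GrpWord ι, GrpWord.eval a w = g := by
  have hs : Function.Surjective (FreeGroup.lift a) :=
    FreeGroup.lift_surjective_iff_closure_range_eq_top.2 ha
  obtain ⟨w, hw⟩ := hs g
  induction w using Quot.inductionOn with
  | h w => exact ⟨w, hw⟩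

theorem Generates.exists_geodesic (ha : Generates a) (x y : G) :
    ∃ w : GrpWord ι, w.length = wordDist a x y ∧ GrpWord.eval a w = x⁻¹ * y := by
  obtain ⟨w, hw⟩ := ha.exists_eval_eq (x⁻¹ * y)
  exact Nat.sInf_mem (s := {n : ℕ | ∃ w : GrpWord ι, w.length = n ∧ GrpWord.eval a w = x⁻¹ * y})
    ⟨_, w, rfl, hw⟩

theorem wordDist_self (x : G) : wordDist a x x = 0 :=
  Nat.le_zero.1 (wordDist_le_length (w := []) (by simp [GrpWord.eval_nil]))

theorem Generates.wordDist_triangle (ha : Generates a) (x y z : G) :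
    wordDist a x z ≤ wordDist a x y + wordDist a y z := by
  obtain ⟨v, hv, hv'⟩ := ha.exists_geodesic x y
  obtain ⟨w, hw, hw'⟩ := ha.exists_geodesic y z
  rw [← hv, ← hw, ← List.length_append]
  exact wordDist_le_length (by rw [GrpWord.eval_append, hv', hw']; group)

theorem Generates.wordDist_comm_le (ha : Generates a) (x y : G) :
    wordDist a x y ≤ wordDist a y x := by
  obtain ⟨v, hv, hv'⟩ := ha.exists_geodesic y x
  rw [← hv, ← FreeGroup.invRev_length]
  exact wordDist_le_length (by rw [GrpWord.eval_invRev, hv']; group)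

theorem Generates.wordDist_comm (ha : Generates a) (x y : G) :
    wordDist a x y = wordDist a y x :=
  (ha.wordDist_comm_le x y).antisymm (ha.wordDist_comm_le y x)

theorem wordDist_one_inv_mul (x y : G) : wordDist a 1 (x⁻¹ * y) = wordDist a x y := by
  simp [wordDist]

theorem Generates.finite_ball [Finite ι] (ha : Generates a) (n : ℕ) :
    {g : G | wordDist a 1 g ≤ n}.Finite := by
  refine ((List.finite_length_le (ι × Bool) n).image (GrpWord.eval a)).subset fun g hg => ?_
  obtain ⟨w, hw, hw'⟩ := ha.exists_geodesic 1 g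
  exact ⟨w, hw.trans_le hg, by simpa using hw'⟩

theorem exists_wordDist_le_of_finset (T : Finset G) :
    ∃ n, ∀ x y : G, x⁻¹ * y ∈ T → wordDist a x y ≤ n :=
  ⟨T.sup (wordDist a 1), fun x y h => by
    rw [← wordDist_one_inv_mul]
    exact Finset.le_sup h⟩

/-- Geodesic words between all pairs of elements, chosen so that exchanging the end points
inverts the word. -/
theorem Generates.exists_symmetric_geodesics (ha : Generates a) :
    ∃ u : GrpCombing a, (∀ x y, (u.word x y).length = wordDist a x y) ∧
      ∀ x y, u.word y x = FreeGroup.invRev (u.word x y) := by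
  classical
  choose w hw hw' using ha.exists_geodesic
  -- An arbitrary total order decides which of the two directions keeps its chosen geodesic; on the
  -- diagonal geodesics are empty.
  let r : G → G → Prop := WellOrderingRel
  have hr : ∀ x y, r x y → ¬ r y x := fun x y => asymm
  have ht : ∀ x y, ¬ r x y → ¬ r y x → x = y := fun x y h h' => by
    rcases trichotomous_of r x y with h1 | h1 | h1
    exacts [absurd h1 h, h1, absurd h1 h']
  have hxx : ∀ x, w x x = [] := fun x => List.length_eq_zero_iff.1 (by rw [hw, wordDist_self])
  refine ⟨⟨fun x y => if r x y then w x y else FreeGroup.invRev (w y x), fun x y => ?_⟩,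
    fun x y => ?_, fun x y => ?_⟩
  · split_ifs
    · exact hw' x y
    · rw [GrpWord.eval_invRev, hw']; group
  · dsimp only
    split_ifs
    · exact hw x y
    · rw [FreeGroup.invRev_length, hw, ha.wordDist_comm]
  · dsimp only
    split_ifs with h1 h2 h2
    · exact absurd h1 (hr _ _ h2)
    · rw [FreeGroup.invRev_invRev]
    · rfl
    · rw [ht x y h2 h1, hxx]; rfl

end WordMetric

/-! ### Quasi-isometries between non-amenable groups -/

section QuasiIsometry

variable {ι κ G H : Type*} [Group G] [Group H] {a : ι → G} {b : κ → H}

theorem IsQuasiIsometry.exists_nat_bound {q : G → H} (hq : IsQuasiIsometry a b q) :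
    ∃ M : ℕ, (∀ x y, wordDist b (q x) (q y) ≤ M * wordDist a x y + M ∧
      wordDist a x y ≤ M * wordDist b (q x) (q y) + M) ∧ ∀ h, ∃ x, wordDist b (q x) h ≤ M := by
  obtain ⟨L, C, hL, hC, hd, hs⟩ := hq
  -- Clearing the denominator in the lower bound produces the additive term `L * C`.
  obtain ⟨M, hM⟩ := exists_nat_ge (L + C + L * C)
  have hLC : 0 ≤ L * C := by positivity
  refine ⟨M, fun x y => ⟨?_, ?_⟩, fun h => ?_⟩
  · have h1 := (hd x y).2
    have h2 : (0 : ℝ) ≤ wordDist a x y := Nat.cast_nonneg _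
    have h3 : (wordDist b (q x) (q y) : ℝ) ≤ M * wordDist a x y + M := by
      have : L * (wordDist a x y : ℝ) ≤ M * wordDist a x y :=
        mul_le_mul_of_nonneg_right (by linarith) h2
      linarith
    exact_mod_cast h3
  · have h1 := (hd x y).1
    have h2 : (0 : ℝ) ≤ wordDist b (q x) (q y) := Nat.cast_nonneg _
    have h3 : (wordDist a x y : ℝ) ≤ M * wordDist b (q x) (q y) + M := by
      rw [sub_le_iff_le_add, div_le_iff₀ (by linarith)] at h1
      have : L * (wordDist b (q x) (q y) : ℝ) ≤ M * wordDist b (q x) (q y) :=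
        mul_le_mul_of_nonneg_right (by linarith) h2
      nlinarith
    exact_mod_cast h3
  · obtain ⟨x, hx⟩ := hs h
    refine ⟨x, ?_⟩
    have : (wordDist b (q x) h : ℝ) ≤ M := by linarith
    exact_mod_cast this

theorem isQuasiIsometry_of_nat_bound {f : G ≃ H} {M : ℕ}
    (hM : ∀ x y, wordDist b (f x) (f y) ≤ M * wordDist a x y + M ∧
      wordDist a x y ≤ M * wordDist b (f x) (f y) + M) : IsQuasiIsometry a b f := by
  refine ⟨M + 1, M + 1, by simp, by positivity, fun x y => ⟨?_, ?_⟩, fun h => ⟨f.symm h, ?_⟩⟩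
  · have h1 : (wordDist a x y : ℝ) ≤ M * wordDist b (f x) (f y) + M := by
      exact_mod_cast (hM x y).2
    have h2 : (0 : ℝ) ≤ wordDist b (f x) (f y) := Nat.cast_nonneg _
    have h3 : (0 : ℝ) ≤ M := Nat.cast_nonneg _
    rw [sub_le_iff_le_add, div_le_iff₀ (by positivity)]
    nlinarith
  · have h1 : (wordDist b (f x) (f y) : ℝ) ≤ M * wordDist a x y + M := by
      exact_mod_cast (hM x y).1
    have h2 : (0 : ℝ) ≤ wordDist a x y := Nat.cast_nonneg _
    nlinarith
  · rw [f.apply_symm_apply, wordDist_self]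
    push_cast
    positivity

/-- Quasi-isometric non-amenable groups are bijectively quasi-isometric. -/
theorem exists_equiv_of_isQuasiIsometry [Finite ι] [Finite κ]
    (hG : ¬ IsAmenableGroup G) (hH : ¬ IsAmenableGroup H)
    (ha : Generates a) (hb : Generates b) {q : G → H} (hq : IsQuasiIsometry a b q) :
    ∃ (f : G ≃ H) (M : ℕ), ∀ x y, wordDist b (f x) (f y) ≤ M * wordDist a x y + M ∧
      wordDist a x y ≤ M * wordDist b (f x) (f y) + M := by
  classical
  obtain ⟨M, hM, hs⟩ := hq.exists_nat_bound
  choose q' hq' using hs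
  have fib1 : ∀ x y, q x = q y → x⁻¹ * y ∈ (ha.finite_ball M).toFinset := fun x y h => by
    rw [Set.Finite.mem_toFinset, Set.mem_ofPred_eq, wordDist_one_inv_mul]
    have := (hM x y).2
    rwa [h, wordDist_self, mul_zero, zero_add] at this
  have fib2 : ∀ x y, q' x = q' y → x⁻¹ * y ∈ (hb.finite_ball (M + M)).toFinset := fun x y h => by
    rw [Set.Finite.mem_toFinset, Set.mem_ofPred_eq, wordDist_one_inv_mul]
    have h1 := hb.wordDist_triangle x (q (q' x)) y
    have h2 := hq' x
    have h3 := hq' y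
    rw [hb.wordDist_comm] at h2
    rw [← h] at h3
    omega
  obtain ⟨T, f₁, hf₁, hT⟩ :=
    exists_injective_near hH q _ (card_le_mul_card_image_of_fiber q _ fib1)
  obtain ⟨T', g₁, hg₁, hT'⟩ :=
    exists_injective_near hG q' _ (card_le_mul_card_image_of_fiber q' _ fib2)
  obtain ⟨n, hn⟩ := exists_wordDist_le_of_finset (a := b) T
  obtain ⟨n', hn'⟩ := exists_wordDist_le_of_finset (a := a) T'
  -- The bijection follows `f₁` at some points and the inverse of `g₁` at the others, so closeness
  -- to `q` is checked for both.
  obtain ⟨f, hf, hfq⟩ := Function.Embedding.schroeder_bernstein_of_rel hf₁ hg₁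
    (fun x h => wordDist b (q x) h ≤ n + M * n' + M + M) (fun x => by
      have := hn _ _ (hT x)
      omega) (fun h => by
      have h1 := hn' _ _ (hT' h)
      have h2 := (hM (q' h) (g₁ h)).1
      have h3 := hq' h
      have h4 := hb.wordDist_triangle (q (g₁ h)) (q (q' h)) h
      rw [hb.wordDist_comm (q (g₁ h)) (q (q' h))] at h4
      have h5 : M * wordDist a (q' h) (g₁ h) ≤ M * n' := by gcongr
      omega)
  set N := n + M * n' + M + M
  refine ⟨Equiv.ofBijective f hf, M + 2 * N + M * (2 * N), fun x y => ?_⟩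
  rw [Equiv.ofBijective_apply, Equiv.ofBijective_apply]
  have h1 := hfq x
  have h2 := hfq y
  have h3 := hb.wordDist_triangle (f x) (q x) (f y)
  have h4 := hb.wordDist_triangle (q x) (q y) (f y)
  have h5 := hb.wordDist_triangle (q x) (f x) (q y)
  have h6 := hb.wordDist_triangle (f x) (f y) (q y)
  rw [hb.wordDist_comm (f x) (q x)] at h3
  rw [hb.wordDist_comm (f y) (q y)] at h6
  obtain ⟨h7, h8⟩ := hM x y
  constructor
  · nlinarith
  · have h9 : M * wordDist b (q x) (q y) ≤ M * (wordDist b (f x) (f y) + 2 * N) := by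
      gcongr
      omega
    have h10 : M * wordDist b (f x) (f y) ≤
        (M + 2 * N + M * (2 * N)) * wordDist b (f x) (f y) := by
      gcongr
      omega
    rw [mul_add] at h9
    omega

end QuasiIsometry


/-! ### Area of elements of the free group -/

section Area

variable {ι : Type*} {R : Set (FreeGroup ι)}

/-- `g` is a product of at most `n` conjugates of relators and inverse relators. -/
def AreaLE (R : Set (FreeGroup ι)) (n : ℕ) (g : FreeGroup ι) : Prop :=
  ∃ l : List (FreeGroup ι), l.length ≤ n ∧ (∀ g ∈ l, g ∈ relatorConj R) ∧ l.prod = g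

theorem AreaLE.one (n : ℕ) : AreaLE R n 1 := ⟨[], by simp, by simp, rfl⟩

theorem AreaLE.mono {m n : ℕ} (h : m ≤ n) {g : FreeGroup ι} (hg : AreaLE R m g) :
    AreaLE R n g := by
  obtain ⟨l, h1, h2, h3⟩ := hg
  exact ⟨l, h1.trans h, h2, h3⟩

theorem AreaLE.mul {m n : ℕ} {g h : FreeGroup ι} (hg : AreaLE R m g) (hh : AreaLE R n h) :
    AreaLE R (m + n) (g * h) := by
  obtain ⟨l, h1, h2, rfl⟩ := hg
  obtain ⟨l', h1', h2', rfl⟩ := hh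
  refine ⟨l ++ l', by simp only [List.length_append]; omega, fun g hg => ?_,
    List.prod_append⟩
  rcases List.mem_append.1 hg with h | h
  exacts [h2 g h, h2' g h]

theorem inv_mem_relatorConj {g : FreeGroup ι} (hg : g ∈ relatorConj R) : g⁻¹ ∈ relatorConj R := by
  obtain ⟨c, r, hr, rfl | rfl⟩ := hg
  · exact ⟨c, r, hr, Or.inr (by group)⟩
  · exact ⟨c, r, hr, Or.inl (by group)⟩

theorem conj_mem_relatorConj {g : FreeGroup ι} (hg : g ∈ relatorConj R) (p : FreeGroup ι) :
    p * g * p⁻¹ ∈ relatorConj R := by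
  obtain ⟨c, r, hr, rfl | rfl⟩ := hg
  · exact ⟨p * c, r, hr, Or.inl (by group)⟩
  · exact ⟨p * c, r, hr, Or.inr (by group)⟩

theorem AreaLE.inv {n : ℕ} {g : FreeGroup ι} (hg : AreaLE R n g) : AreaLE R n g⁻¹ := by
  obtain ⟨l, h1, h2, rfl⟩ := hg
  refine ⟨(l.map (·⁻¹)).reverse, by simpa using h1, fun g hg => ?_, (List.prod_inv_reverse l).symm⟩
  rw [List.mem_reverse, List.mem_map] at hg
  obtain ⟨k, hk, rfl⟩ := hg
  exact inv_mem_relatorConj (h2 k hk)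

theorem AreaLE.conj {n : ℕ} {g : FreeGroup ι} (hg : AreaLE R n g) (p : FreeGroup ι) :
    AreaLE R n (p * g * p⁻¹) := by
  obtain ⟨l, h1, h2, rfl⟩ := hg
  refine ⟨l.map (MulAut.conj p), by simpa using h1, fun g hg => ?_, ?_⟩
  · obtain ⟨k, hk, rfl⟩ := List.mem_map.1 hg
    exact conj_mem_relatorConj (h2 k hk) p
  · rw [← map_list_prod, MulAut.conj_apply]

theorem areaLE_one_of_mem {r : FreeGroup ι} (hr : r ∈ R) : AreaLE R 1 r :=
  ⟨[r], by simp, by simpa using ⟨1, r, hr, Or.inl (by group)⟩, by simp⟩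

theorem AreaLE.mem_normalClosure {n : ℕ} {g : FreeGroup ι} (hg : AreaLE R n g) :
    g ∈ Subgroup.normalClosure R := by
  obtain ⟨l, -, h2, rfl⟩ := hg
  refine Subgroup.list_prod_mem _ fun g hg => ?_
  obtain ⟨c, r, hr, rfl | rfl⟩ := h2 g hg
  · exact Subgroup.normalClosure_normal.conj_mem _ (Subgroup.subset_normalClosure hr) c
  · exact Subgroup.normalClosure_normal.conj_mem _
      (Subgroup.inv_mem _ (Subgroup.subset_normalClosure hr)) c

/-- The elements of finite area form a normal subgroup that contains `R`. -/
theorem exists_areaLE_of_mem_normalClosure {g : FreeGroup ι}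
    (hg : g ∈ Subgroup.normalClosure R) : ∃ n, AreaLE R n g := by
  let N : Subgroup (FreeGroup ι) :=
    { carrier := {g | ∃ n, AreaLE R n g}
      one_mem' := ⟨0, .one 0⟩
      mul_mem' := fun ⟨m, hm⟩ ⟨n, hn⟩ => ⟨m + n, hm.mul hn⟩
      inv_mem' := fun ⟨n, hn⟩ => ⟨n, hn.inv⟩ }
  have : N.Normal := ⟨fun _ ⟨n, hn⟩ p => ⟨n, hn.conj p⟩⟩
  exact Subgroup.normalClosure_le_normal (N := N) (fun r hr => ⟨1, areaLE_one_of_mem hr⟩) hg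

theorem AreaLE.area_le {n : ℕ} {w : GrpWord ι} (h : AreaLE R n (FreeGroup.mk w)) :
    area R w ≤ n := by
  obtain ⟨l, h1, h2, h3⟩ := h
  exact (Nat.sInf_le ⟨l, rfl, h2, h3⟩ : area R w ≤ l.length).trans h1

variable {G : Type*} [Group G] {a : ι → G}

theorem IsFinitePresentation.exists_areaLE (hP : IsFinitePresentation a R) {w : GrpWord ι}
    (hw : GrpWord.eval a w = 1) : ∃ n, AreaLE R n (FreeGroup.mk w) :=
  exists_areaLE_of_mem_normalClosure (by rw [hP.2.2]; exact hw)

/-- Null-homotopy makes the set in `area` nonempty, so that the infimum is attained and is not the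
default value `0`. -/
theorem IsFinitePresentation.areaLE_area (hP : IsFinitePresentation a R) {w : GrpWord ι}
    (hw : GrpWord.eval a w = 1) : AreaLE R (area R w) (FreeGroup.mk w) := by
  obtain ⟨n, l, -, h2, h3⟩ := hP.exists_areaLE hw
  obtain ⟨l', h1', h2', h3'⟩ := Nat.sInf_mem (s := {n : ℕ | ∃ l : List (FreeGroup ι),
    l.length = n ∧ (∀ g ∈ l, g ∈ relatorConj R) ∧ l.prod = FreeGroup.mk w}) ⟨_, l, rfl, h2, h3⟩
  exact ⟨l', h1'.le, h2', h3'⟩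

/-- Null-homotopic words of bounded length have bounded area. -/
theorem IsFinitePresentation.exists_area_bound [Finite ι] (hP : IsFinitePresentation a R) (N : ℕ) :
    ∃ A, ∀ w : GrpWord ι, w.length ≤ N → GrpWord.eval a w = 1 → AreaLE R A (FreeGroup.mk w) := by
  have hfin := List.finite_length_le (ι × Bool) N
  refine ⟨hfin.toFinset.sup (area R), fun w hw h => (hP.areaLE_area h).mono ?_⟩
  exact Finset.le_sup (f := area R) (hfin.mem_toFinset.2 hw)

theorem IsFinitePresentation.lift_relator (hP : IsFinitePresentation a R) {r : FreeGroup ι}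
    (hr : r ∈ R) : FreeGroup.lift a r = 1 := by
  rw [← MonoidHom.mem_ker, ← hP.2.2]
  exact Subgroup.subset_normalClosure hr

/-- The relators of a finite presentation are represented by words of bounded length. -/
theorem exists_bounded_representatives (hR : R.Finite) :
    ∃ N : ℕ, ∀ r ∈ R, ∃ w : GrpWord ι, w.length ≤ N ∧ FreeGroup.mk w = r := by
  choose w hw using fun r : FreeGroup ι => (Quot.exists_rep r : ∃ w, FreeGroup.mk w = r)
  exact ⟨hR.toFinset.sup fun r => (w r).length, fun r hr =>
    ⟨w r, Finset.le_sup (f := fun r => (w r).length) (hR.mem_toFinset.2 hr), hw r⟩⟩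

end Area

/-! ### Images of edge paths -/

section ImagePath

open GrpCombing

variable {ι κ G H : Type*} [Group G] [Group H] {a : ι → G} {b : κ → H} {f : G → H}
  {u : GrpCombing b}

theorem GrpWord.eval_cons (s : ι × Bool) (w : GrpWord ι) :
    GrpWord.eval a (s :: w) = GrpWord.eval a [s] * GrpWord.eval a w := by
  rw [← List.singleton_append, GrpWord.eval_append]

theorem imageWord_append (v w : GrpWord ι) (x : G) :
    imageWord a f u x (v ++ w) =
      imageWord a f u x v ++ imageWord a f u (x * GrpWord.eval a v) w := by
  induction v generalizing x with
  | nil => simp [imageWord, GrpWord.eval_nil]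
  | cons s v ih =>
    rw [List.cons_append, imageWord, imageWord, ih, List.append_assoc, GrpWord.eval_cons s v,
      mul_assoc]

theorem eval_imageWord (w : GrpWord ι) (x : G) :
    GrpWord.eval b (imageWord a f u x w) = (f x)⁻¹ * f (x * GrpWord.eval a w) := by
  induction w generalizing x with
  | nil => simp [imageWord, GrpWord.eval_nil]
  | cons s w ih =>
    rw [imageWord, GrpWord.eval_append, u.eval_word, ih, GrpWord.eval_cons s w, mul_assoc x]
    group

/-- The edges of the Cayley graph of `a` are sent to paths of length at most `M`. -/
def BoundsEdges (a : ι → G) (f : G → H) (u : GrpCombing b) (M : ℕ) : Prop :=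
  ∀ (x : G) (s : ι × Bool), (u.word (f x) (f (x * GrpWord.eval a [s]))).length ≤ M

theorem BoundsEdges.length_imageWord_le {M : ℕ} (hM : BoundsEdges a f u M) (w : GrpWord ι)
    (x : G) : (imageWord a f u x w).length ≤ M * w.length := by
  induction w generalizing x with
  | nil => simp [imageWord]
  | cons s w ih =>
    rw [imageWord, List.length_append, List.length_cons, mul_add, mul_one]
    have := ih (x * GrpWord.eval a [s])
    have := hM x s
    omega

/-- The image of the edge path starting at `x`, as an element of the free group. -/
def imagePath (a : ι → G) (f : G → H) (u : GrpCombing b)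
    (hu : ∀ x y, u.word y x = FreeGroup.invRev (u.word x y)) (x : G) :
    FreeGroup ι → FreeGroup κ :=
  -- A cancelling pair of letters goes along an edge and back; by `hu` the images of the two
  -- passages are formal inverses.
  Quot.lift (fun w => FreeGroup.mk (imageWord a f u x w)) (by
    rintro _ _ ⟨⟩
    rename_i v w i c
    have hs : GrpWord.eval a [(i, c)] * GrpWord.eval a [(i, !c)] = 1 := by
      rw [← GrpWord.eval_append]
      cases c <;> simp [GrpWord.eval, FreeGroup.lift_mk]
    rw [imageWord_append, imageWord_append, imageWord, imageWord, mul_assoc (x * GrpWord.eval a v),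
      hs, mul_one, hu (f (x * GrpWord.eval a v)) (f (x * GrpWord.eval a v * _)), ← FreeGroup.mul_mk,
      ← FreeGroup.mul_mk, ← FreeGroup.mul_mk, ← FreeGroup.mul_mk, ← FreeGroup.inv_mk]
    group)

variable {hu : ∀ x y, u.word y x = FreeGroup.invRev (u.word x y)}

theorem imagePath_mk (x : G) (w : GrpWord ι) :
    imagePath a f u hu x (FreeGroup.mk w) = FreeGroup.mk (imageWord a f u x w) := rfl

theorem imagePath_one (x : G) : imagePath a f u hu x 1 = 1 := rfl

theorem imagePath_mul (x : G) (g h : FreeGroup ι) :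
    imagePath a f u hu x (g * h) =
      imagePath a f u hu x g * imagePath a f u hu (x * FreeGroup.lift a g) h := by
  induction g using Quot.inductionOn with | h v
  induction h using Quot.inductionOn with | h w
  simp only [FreeGroup.quot_mk_eq_mk, FreeGroup.mul_mk, imagePath_mk, imageWord_append]
  rfl

theorem imagePath_inv (x : G) (g : FreeGroup ι) :
    imagePath a f u hu x g⁻¹ = (imagePath a f u hu (x * (FreeGroup.lift a g)⁻¹) g)⁻¹ := by
  have h := imagePath_mul (hu := hu) (f := f) (a := a) x g⁻¹ g
  rw [inv_mul_cancel, imagePath_one, map_inv] at h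
  exact eq_inv_of_mul_eq_one_left h.symm

/-- Since `g` closes up, the final `c⁻¹` retraces the image of the initial `c`. -/
theorem imagePath_conj (x : G) (c g : FreeGroup ι) (hg : FreeGroup.lift a g = 1) :
    imagePath a f u hu x (c * g * c⁻¹) = imagePath a f u hu x c *
      imagePath a f u hu (x * FreeGroup.lift a c) g * (imagePath a f u hu x c)⁻¹ := by
  rw [imagePath_mul, imagePath_mul, imagePath_inv, map_mul, hg, mul_one, mul_inv_cancel_right]

/-- Fillings are carried along by the image of edge paths. -/
theorem AreaLE.imagePath {R : Set (FreeGroup ι)} {R' : Set (FreeGroup κ)} {A : ℕ}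
    (hR : ∀ r ∈ R, FreeGroup.lift a r = 1)
    (hA : ∀ r ∈ R, ∀ x, AreaLE R' A (imagePath a f u hu x r)) {n : ℕ} {g : FreeGroup ι}
    (hg : AreaLE R n g) (x : G) : AreaLE R' (A * n) (imagePath a f u hu x g) := by
  obtain ⟨l, h1, h2, rfl⟩ := hg
  refine AreaLE.mono (Nat.mul_le_mul_left A h1) ?_
  clear h1
  induction l generalizing x with
  | nil => exact .one _
  | cons g l ih =>
    rw [List.prod_cons, imagePath_mul, List.length_cons, mul_add, mul_one, add_comm]
    refine AreaLE.mul ?_ (ih _ fun g hg => h2 g (List.mem_cons_of_mem _ hg))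
    obtain ⟨c, r, hr, rfl | rfl⟩ := h2 g List.mem_cons_self
    · rw [imagePath_conj x c r (hR r hr)]
      exact (hA r hr _).conj _
    · rw [imagePath_conj x c _ (by rw [map_inv, hR r hr, inv_one]), imagePath_inv]
      exact (hA r hr _).inv.conj _

/-- A word is homotopic to its image under `f`, followed by a left inverse of `f`, by a homotopy
whose area is linear in the length of the word. -/
theorem areaLE_mul_imageWord_imageWord_inv {R : Set (FreeGroup ι)} {g : H → G}
    {v : GrpCombing a} {A : ℕ}
    (hA : ∀ (x : G) (s : ι × Bool), AreaLE R A (FreeGroup.mk [s] * (FreeGroup.mk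
      (imageWord b g v (f x) (u.word (f x) (f (x * GrpWord.eval a [s])))))⁻¹))
    (w : GrpWord ι) (x : G) :
    AreaLE R (A * w.length) (FreeGroup.mk w *
      (FreeGroup.mk (imageWord b g v (f x) (imageWord a f u x w)))⁻¹) := by
  induction w generalizing x with
  | nil => simpa [imageWord, ← FreeGroup.one_eq_mk] using AreaLE.one _
  | cons s w ih =>
    rw [imageWord, imageWord_append, u.eval_word, mul_inv_cancel_left, ← FreeGroup.mul_mk,
      ← List.singleton_append, ← FreeGroup.mul_mk, List.length_append, mul_add,
      List.length_singleton, mul_one]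
    set p := FreeGroup.mk (imageWord b g v (f x) (u.word (f x) (f (x * GrpWord.eval a [s]))))
    have h0 : AreaLE R A (FreeGroup.mk [s] * p⁻¹) := hA x s
    -- With `W` the rest of the word and `Q` its round-trip image, `s W (p Q)⁻¹ = (s p⁻¹) · p (W
    -- Q⁻¹) p⁻¹`.
    have h := h0.mul ((ih (x * GrpWord.eval a [s])).conj p)
    convert h using 1
    group

end ImagePath


/-! ### Push-forward of fillings, presentations and combings -/

section Transfer

open GrpCombing

variable {ι κ G H : Type*} [Group G] [Group H] {a : ι → G} {b : κ → H} {f : G → H}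
  {u : GrpCombing b}

theorem areaLE_imagePath_relator {R : Set (FreeGroup ι)} {R' : Set (FreeGroup κ)}
    {hu : ∀ x y, u.word y x = FreeGroup.invRev (u.word x y)} {M N L A : ℕ}
    (hM : BoundsEdges a f u M)
    (hR : ∀ r ∈ R, FreeGroup.lift a r = 1)
    (hN : ∀ r ∈ R, ∃ w : GrpWord ι, w.length ≤ N ∧ FreeGroup.mk w = r)
    (hL : M * N ≤ L)
    (hA : ∀ w : GrpWord κ, w.length ≤ L → GrpWord.eval b w = 1 → AreaLE R' A (FreeGroup.mk w)) :
    ∀ r ∈ R, ∀ x, AreaLE R' A (imagePath a f u hu x r) := by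
  intro r hr x
  obtain ⟨w, hw, rfl⟩ := hN r hr
  have hw1 : GrpWord.eval a w = 1 := hR _ hr
  rw [imagePath_mk]
  refine hA _ ((hM.length_imageWord_le w x).trans (le_trans (by gcongr) hL)) ?_
  rw [eval_imageWord, hw1, mul_one, inv_mul_cancel]

/-- An edge and its round-trip image bound a loop of length at most `1 + M' * M`. -/
theorem areaLE_letter_mul_imageWord_inv {R : Set (FreeGroup ι)} {g : H → G} {v : GrpCombing a}
    {M M' L A : ℕ} (hM : BoundsEdges a f u M) (hM' : BoundsEdges b g v M')
    (hgf : ∀ x, g (f x) = x) (hL : 1 + M' * M ≤ L)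
    (hA : ∀ w : GrpWord ι, w.length ≤ L → GrpWord.eval a w = 1 → AreaLE R A (FreeGroup.mk w))
    (x : G) (s : ι × Bool) : AreaLE R A (FreeGroup.mk [s] * (FreeGroup.mk
      (imageWord b g v (f x) (u.word (f x) (f (x * GrpWord.eval a [s])))))⁻¹) := by
  rw [FreeGroup.inv_mk, FreeGroup.mul_mk]
  refine hA _ ?_ ?_
  · rw [List.length_append, FreeGroup.invRev_length, List.length_singleton]
    have h1 := hM'.length_imageWord_le (u.word (f x) (f (x * GrpWord.eval a [s]))) (f x)
    have h2 : M' * (u.word (f x) (f (x * GrpWord.eval a [s]))).length ≤ M' * M := by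
      gcongr
      exact hM x s
    omega
  · rw [GrpWord.eval_append, GrpWord.eval_invRev, eval_imageWord, u.eval_word,
      mul_inv_cancel_left, hgf, hgf]
    group

theorem boundsEdges_of_lipschitz {M : ℕ}
    (hM : ∀ x y, wordDist b (f x) (f y) ≤ M * wordDist a x y + M)
    (hu : ∀ h h', (u.word h h').length = wordDist b h h') : BoundsEdges a f u (M + M) := by
  intro x s
  rw [hu]
  have h1 : wordDist a x (x * GrpWord.eval a [s]) ≤ 1 := wordDist_le_length (w := [s]) (by group)
  have h2 := hM x (x * GrpWord.eval a [s])
  have h3 : M * wordDist a x (x * GrpWord.eval a [s]) ≤ M * 1 := by gcongr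
  omega

/-- Finite presentability is transported by a bijective quasi-isometry. -/
theorem exists_isFinitePresentation_of_equiv [Finite κ] {R : Set (FreeGroup ι)}
    (hP : IsFinitePresentation a R) (hb : Generates b) (f : G ≃ H) {M M' : ℕ} {v : GrpCombing a}
    (hu : ∀ x y, u.word y x = FreeGroup.invRev (u.word x y))
    (hM : BoundsEdges a f u M) (hM' : BoundsEdges b f.symm v M') :
    ∃ R' : Set (FreeGroup κ), IsFinitePresentation b R' := by
  obtain ⟨N, hN⟩ := exists_bounded_representatives hP.1
  -- All null-homotopic words up to length `L` become relators: `M * N` covers images of relators of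
  -- `G`, and `1 + M * M'` covers round trips of edges of `H`.
  let L := M * N + (1 + M * M')
  let R' : Set (FreeGroup κ) :=
    FreeGroup.mk '' ({w : GrpWord κ | w.length ≤ L} ∩ {w | GrpWord.eval b w = 1})
  have hA : ∀ w : GrpWord κ, w.length ≤ L → GrpWord.eval b w = 1 →
      AreaLE R' 1 (FreeGroup.mk w) := fun w h1 h2 => areaLE_one_of_mem ⟨w, ⟨h1, h2⟩, rfl⟩
  refine ⟨R', ((List.finite_length_le _ L).inter_of_left _).image _, hb, le_antisymm ?_ ?_⟩
  · refine Subgroup.normalClosure_le_normal ?_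
    rintro _ ⟨w, ⟨-, hw⟩, rfl⟩
    exact hw
  · intro g hg
    induction g using Quot.inductionOn with | h V
    have hV : GrpWord.eval b V = 1 := hg
    have h1 : GrpWord.eval a (imageWord b f.symm v 1 V) = 1 := by
      rw [eval_imageWord, hV, mul_one, inv_mul_cancel]
    -- The word `V` is filled after transport to `G`; the filling is carried back and joined to `V`
    -- by the round-trip homotopy.
    obtain ⟨n, hn⟩ := hP.exists_areaLE h1
    have h2 := hn.imagePath (f := f) (fun r hr => hP.lift_relator hr)
      (areaLE_imagePath_relator (hu := hu) hM (fun r hr => hP.lift_relator hr) hN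
        (Nat.le_add_right _ _) hA) (f.symm 1)
    have h3 := areaLE_mul_imageWord_imageWord_inv (areaLE_letter_mul_imageWord_inv hM' hM
      f.apply_symm_apply (Nat.le_add_left _ _) hA) V 1
    have h4 := (h3.mul h2).mem_normalClosure
    rwa [imagePath_mk, inv_mul_cancel_right] at h4

/-- The combing whose lines are the images under `f` of the combing lines of `α`. -/
def pushCombing (f : G ≃ H) (α : GrpCombing a) (u : GrpCombing b) : GrpCombing b where
  word h h' := imageWord a f u (f.symm h) (α.word (f.symm h) (f.symm h'))
  eval_word h h' := by
    rw [eval_imageWord, α.eval_word, mul_inv_cancel_left, f.apply_symm_apply, f.apply_symm_apply]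

theorem chainWord_pushCombing (f : G ≃ H) (α : GrpCombing a) (l : List G) (x : G) :
    (pushCombing f α u).chainWord (f x) (l.map f) = imageWord a f u x (α.chainWord x l) := by
  induction l generalizing x with
  | nil => rfl
  | cons y l ih =>
    rw [List.map_cons, chainWord, chainWord, imageWord_append, ih, α.eval_word,
      mul_inv_cancel_left]
    simp only [pushCombing, f.symm_apply_apply]

/-- The closing combing line is run backwards, and by the symmetry of `u` the image of a reversed
path is the inverse of the image. -/
theorem mk_loopWord_pushCombing (f : G ≃ H) (α : GrpCombing a)
    (hu : ∀ x y, u.word y x = FreeGroup.invRev (u.word x y)) (l : List G) (x : G) :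
    FreeGroup.mk ((pushCombing f α u).loopWord (f x) (l.map f)) =
      imagePath a f u hu x (FreeGroup.mk (α.loopWord x l)) := by
  have hlast : (l.map f).getLastD (f x) = f (l.getLastD x) := by
    rw [List.getLastD_eq_getLast?, List.getLastD_eq_getLast?, List.getLast?_map,
      Option.getD_map]
  have hend : FreeGroup.lift a (FreeGroup.mk (α.chainWord x l)) = x⁻¹ * l.getLastD x :=
    eval_chainWord α l x
  have hend' : FreeGroup.lift a (FreeGroup.mk (α.word x (l.getLastD x))) = x⁻¹ * l.getLastD x :=
    α.eval_word x _
  rw [loopWord, loopWord, chainWord_pushCombing, hlast, ← FreeGroup.mul_mk, ← FreeGroup.mul_mk,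
    imagePath_mul, ← FreeGroup.inv_mk, ← FreeGroup.inv_mk, imagePath_inv, hend, hend',
    mul_inv_cancel_left, mul_inv_rev, inv_inv, mul_inv_cancel_left, imagePath_mk, imagePath_mk]
  simp only [pushCombing, f.symm_apply_apply]

/-- Areas of loops and of their images under a bijective quasi-isometry are comparable, up to an
error that is linear in the length of the loop. -/
theorem exists_area_loopWord_comparison [Finite ι] [Finite κ] {R : Set (FreeGroup ι)}
    {R' : Set (FreeGroup κ)} (hP : IsFinitePresentation a R) (hP' : IsFinitePresentation b R')
    (f : G ≃ H) (α : GrpCombing a) {M M' : ℕ} {v : GrpCombing a}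
    (hu : ∀ x y, u.word y x = FreeGroup.invRev (u.word x y))
    (hv : ∀ x y, v.word y x = FreeGroup.invRev (v.word x y))
    (hM : BoundsEdges a f u M) (hM' : BoundsEdges b f.symm v M') :
    ∃ A : ℕ, ∀ (x : G) (l : List G),
      area R' ((pushCombing f α u).loopWord (f x) (l.map f)) ≤ A * area R (α.loopWord x l) ∧
      area R (α.loopWord x l) ≤ A * area R' ((pushCombing f α u).loopWord (f x) (l.map f)) +
        A * (α.loopWord x l).length := by
  obtain ⟨N, hN⟩ := exists_bounded_representatives hP.1
  obtain ⟨N', hN'⟩ := exists_bounded_representatives hP'.1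
  obtain ⟨A, hA⟩ := hP.exists_area_bound (M' * N' + (1 + M' * M))
  obtain ⟨A', hA'⟩ := hP'.exists_area_bound (M * N)
  refine ⟨A + A', fun x l => ⟨?_, ?_⟩⟩
  · refine AreaLE.area_le ?_
    rw [mk_loopWord_pushCombing f α hu]
    refine AreaLE.mono (Nat.mul_le_mul_right _ (Nat.le_add_left A' A)) ?_
    exact (hP.areaLE_area (eval_loopWord α x l)).imagePath (fun r hr => hP.lift_relator hr)
      (areaLE_imagePath_relator hM (fun r hr => hP.lift_relator hr) hN le_rfl hA') x
  · refine AreaLE.area_le ?_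
    -- An optimal filling of the image loop is pulled back by `f.symm`; the round-trip homotopy `h2`
    -- then accounts for the term linear in the length.
    have h1 := (hP'.areaLE_area (eval_loopWord (pushCombing f α u) (f x) (l.map f))).imagePath
      (f := f.symm) (fun r hr => hP'.lift_relator hr)
      (areaLE_imagePath_relator (hu := hv) hM' (fun r hr => hP'.lift_relator hr) hN'
        (Nat.le_add_right _ _) hA) (f x)
    rw [mk_loopWord_pushCombing f α hu, imagePath_mk, imagePath_mk] at h1
    have h2 := areaLE_mul_imageWord_imageWord_inv (areaLE_letter_mul_imageWord_inv hM hM'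
      f.symm_apply_apply (Nat.le_add_left _ _) hA) (α.loopWord x l) x
    have h3 := h2.mul h1
    rw [inv_mul_cancel_right] at h3
    refine h3.mono ?_
    rw [add_comm]
    gcongr <;> omega

end Transfer

/-! ### Quasi-geodesic combings -/

section QuasiGeodesic

open GrpCombing

variable {ι κ G H : Type*} [Group G] [Group H] {a : ι → G} {b : κ → H}

theorem wordDist_vertex_le (x : G) (w : GrpWord ι) {i j : ℕ} (hij : i ≤ j) :
    wordDist a (GrpWord.vertex a x w i) (GrpWord.vertex a x w j) ≤ j - i := by
  have h : GrpWord.eval a ((w.take j).drop i) =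
      (GrpWord.vertex a x w i)⁻¹ * GrpWord.vertex a x w j := by
    have h1 : w.take j = w.take i ++ (w.take j).drop i := by
      conv_lhs => rw [← List.take_append_drop i (w.take j), List.take_take, min_eq_left hij]
    rw [GrpWord.vertex, GrpWord.vertex, h1, GrpWord.eval_append, ← h1]
    group
  refine (wordDist_le_length h).trans ?_
  rw [List.length_drop, List.length_take]
  omega

/-- Edge paths are 1-Lipschitz, so only the lower bound on distances has content. -/
theorem isQuasiGeodesic_iff_exists_nat {α : GrpCombing a} : α.IsQuasiGeodesic ↔
    ∃ c : ℕ, ∀ (x y : G) (i j : ℕ), i ≤ j → j ≤ (α.word x y).length →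
      j ≤ i + c * wordDist a (GrpWord.vertex a x (α.word x y) i)
        (GrpWord.vertex a x (α.word x y) j) + c := by
  constructor
  · rintro ⟨D, hD, h⟩
    obtain ⟨c, hc⟩ := exists_nat_ge (D + D * D)
    refine ⟨c, fun x y i j hij hj => ?_⟩
    have h1 := (h x y i j hij hj).1
    rw [sub_le_iff_le_add, div_le_iff₀ (by linarith)] at h1
    set d := wordDist a (GrpWord.vertex a x (α.word x y) i) (GrpWord.vertex a x (α.word x y) j)
    have hd : (0 : ℝ) ≤ d := Nat.cast_nonneg _
    have h2 : (j : ℝ) ≤ i + c * d + c := by nlinarith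
    exact_mod_cast h2
  · rintro ⟨c, h⟩
    refine ⟨c + 1, by simp, fun x y i j hij hj => ⟨?_, ?_⟩⟩
    · have h1 := h x y i j hij hj
      set d := wordDist a (GrpWord.vertex a x (α.word x y) i) (GrpWord.vertex a x (α.word x y) j)
      have h2 : (j : ℝ) ≤ i + c * d + c := by exact_mod_cast h1
      have hd : (0 : ℝ) ≤ d := Nat.cast_nonneg _
      have hc : (0 : ℝ) ≤ c := Nat.cast_nonneg _
      rw [sub_le_iff_le_add, div_le_iff₀ (by positivity)]
      nlinarith
    · have h1 := wordDist_vertex_le (a := a) x (α.word x y) hij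
      have h2 : (wordDist a (GrpWord.vertex a x (α.word x y) i)
          (GrpWord.vertex a x (α.word x y) j) : ℝ) ≤ j - i := by
        rw [← Nat.cast_sub hij]
        exact_mod_cast h1
      have h3 : (0 : ℝ) ≤ (j : ℝ) - i := sub_nonneg.2 (by exact_mod_cast hij)
      have hc : (0 : ℝ) ≤ c := Nat.cast_nonneg _
      nlinarith

/-- This is the lower quasi-geodesic bound at the two end points of the line. -/
theorem GrpCombing.IsQuasiGeodesic.exists_length_le {α : GrpCombing a} (hα : α.IsQuasiGeodesic) :
    ∃ c : ℕ, ∀ x y, (α.word x y).length ≤ c * wordDist a x y + c := by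
  obtain ⟨c, hc⟩ := isQuasiGeodesic_iff_exists_nat.1 hα
  refine ⟨c, fun x y => ?_⟩
  have h := hc x y 0 _ (Nat.zero_le _) le_rfl
  rwa [GrpWord.vertex, GrpWord.vertex, List.take_zero, List.take_length, GrpWord.eval_nil,
    α.eval_word, mul_one, mul_inv_cancel_left, zero_add] at h

theorem BoundsEdges.exists_take_imageWord {f : G → H} {u : GrpCombing b} {M : ℕ}
    (hM : BoundsEdges a f u M) (w : GrpWord ι) (x : G) (i : ℕ)
    (hi : i ≤ (imageWord a f u x w).length) :
    ∃ k ≤ w.length, (imageWord a f u x (w.take k)).length ≤ i ∧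
      i ≤ (imageWord a f u x (w.take k)).length + M := by
  induction w using List.reverseRecOn with
  | nil => exact ⟨0, le_rfl, by simp [imageWord], by simp_all [imageWord]⟩
  | append_singleton w s ih =>
    rcases le_total i (imageWord a f u x w).length with h | h
    · obtain ⟨k, hk, h1, h2⟩ := ih h
      refine ⟨k, hk.trans (by simp), ?_⟩
      rw [List.take_append_of_le_length hk]
      exact ⟨h1, h2⟩
    · refine ⟨w.length, by simp, ?_⟩
      rw [List.take_left]
      refine ⟨h, hi.trans ?_⟩
      rw [imageWord_append, List.length_append]
      have := hM.length_imageWord_le [s] (x * GrpWord.eval a w)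
      simpa using this

theorem vertex_imageWord_length_take {f : G → H} {u : GrpCombing b} (w : GrpWord ι) (x : G)
    (k : ℕ) : GrpWord.vertex b (f x) (imageWord a f u x w) (imageWord a f u x (w.take k)).length =
      f (GrpWord.vertex a x w k) := by
  have h : imageWord a f u x w = imageWord a f u x (w.take k) ++
      imageWord a f u (x * GrpWord.eval a (w.take k)) (w.drop k) := by
    rw [← imageWord_append, List.take_append_drop]
  rw [GrpWord.vertex, h, List.take_left, eval_imageWord, mul_inv_cancel_left, GrpWord.vertex]

theorem length_imageWord_take_le {f : G → H} {u : GrpCombing b} {M : ℕ}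
    (hM : BoundsEdges a f u M) (w : GrpWord ι) (x : G) {k l : ℕ} (hkl : k ≤ l) :
    (imageWord a f u x (w.take k)).length ≤ (imageWord a f u x (w.take l)).length ∧
    (imageWord a f u x (w.take l)).length ≤
      (imageWord a f u x (w.take k)).length + M * (l - k) := by
  have h : imageWord a f u x (w.take l) = imageWord a f u x (w.take k) ++
      imageWord a f u (x * GrpWord.eval a (w.take k)) ((w.take l).drop k) := by
    rw [← imageWord_append]
    conv_lhs => rw [← List.take_append_drop k (w.take l), List.take_take, min_eq_left hkl]
  rw [h, List.length_append]
  refine ⟨Nat.le_add_right _ _, Nat.add_le_add_left ((hM.length_imageWord_le _ _).trans ?_) _⟩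
  rw [List.length_drop, List.length_take]
  gcongr
  omega

/-- Positions on the image path lie within `M` of images of vertices of the original line, for which
the bound is inherited through `hf`. -/
theorem isQuasiGeodesic_pushCombing (hb : Generates b) {f : G ≃ H} {u : GrpCombing b}
    {α : GrpCombing a} (hα : α.IsQuasiGeodesic) {M M' : ℕ} (hM : BoundsEdges a f u M)
    (hf : ∀ x y, wordDist a x y ≤ M' * wordDist b (f x) (f y) + M') :
    (pushCombing f α u).IsQuasiGeodesic := by
  obtain ⟨c, hc⟩ := isQuasiGeodesic_iff_exists_nat.1 hα
  refine isQuasiGeodesic_iff_exists_nat.2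
    -- The first summand is the slope in `h11`, the bracket the additive error; their sum serves as
    -- both constants.
    ⟨M * c * M' + (M * (c * (M' * (2 * M) + M') + c) + M), fun h h' i j hij hj => ?_⟩
  obtain ⟨x, rfl⟩ := f.surjective h
  obtain ⟨y, rfl⟩ := f.surjective h'
  simp only [pushCombing, f.symm_apply_apply] at hj ⊢
  set w := α.word x y with hw
  obtain ⟨k, hk, hk1, hk2⟩ := hM.exists_take_imageWord w x i (hij.trans hj)
  obtain ⟨l, hl, hl1, hl2⟩ := hM.exists_take_imageWord w x j hj
  rcases le_total k l with hkl | hkl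
  · have h1 := (length_imageWord_take_le hM w x hkl).2
    have h2 := hc x y k l hkl hl
    rw [← hw] at h2
    have h3 := hf (GrpWord.vertex a x w k) (GrpWord.vertex a x w l)
    have h4 := wordDist_vertex_le (a := b) (f x) (imageWord a f u x w) hk1
    have h5 := wordDist_vertex_le (a := b) (f x) (imageWord a f u x w) hl1
    rw [vertex_imageWord_length_take] at h4 h5
    have h6 := hb.wordDist_triangle (f (GrpWord.vertex a x w k))
      (GrpWord.vertex b (f x) (imageWord a f u x w) i) (f (GrpWord.vertex a x w l))
    have h7 := hb.wordDist_triangle (GrpWord.vertex b (f x) (imageWord a f u x w) i)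
      (GrpWord.vertex b (f x) (imageWord a f u x w) j) (f (GrpWord.vertex a x w l))
    rw [hb.wordDist_comm (GrpWord.vertex b (f x) (imageWord a f u x w) j)] at h7
    set d := wordDist b (GrpWord.vertex b (f x) (imageWord a f u x w) i)
      (GrpWord.vertex b (f x) (imageWord a f u x w) j)
    have h8 : wordDist b (f (GrpWord.vertex a x w k)) (f (GrpWord.vertex a x w l)) ≤
        d + 2 * M := by omega
    have h9 : l - k ≤ c * (M' * (d + 2 * M) + M') + c := by
      have : c * wordDist a (GrpWord.vertex a x w k) (GrpWord.vertex a x w l) ≤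
          c * (M' * (d + 2 * M) + M') := by
        gcongr
        exact h3.trans (by gcongr)
      omega
    have h10 : M * (l - k) ≤ M * (c * (M' * (d + 2 * M) + M') + c) := by gcongr
    have h11 : M * (c * (M' * (d + 2 * M) + M') + c) =
        M * c * M' * d + M * (c * (M' * (2 * M) + M') + c) := by ring
    rw [add_mul]
    have h12 := Nat.zero_le ((M * (c * (M' * (2 * M) + M') + c) + M) * d)
    omega
  -- The vertices `k` and `l` are chosen independently, so `l ≤ k` may occur; then `j ≤ i + M`.
  · have h1 := (length_imageWord_take_le hM w x hkl).1
    rw [add_mul]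
    omega

end QuasiGeodesic


/-! ### Push-forward of Markov chains -/

theorem PMF.map_equiv_apply {X Y : Type*} (e : X ≃ Y) (p : PMF X) (x : X) :
    p.map e (e x) = p x := by
  classical
  rw [PMF.map_apply, tsum_eq_single x]
  · simp
  · intro y hy
    rw [if_neg]
    exact fun h => hy (e.injective h).symm

theorem PMF.tsum_map_equiv {X Y : Type*} (e : X ≃ Y) (p : PMF X) (F : Y → ℝ≥0∞) :
    ∑' y, p.map e y * F y = ∑' x, p x * F (e x) := by
  rw [← e.tsum_eq]
  simp only [PMF.map_equiv_apply]

/-- If `F ≤ A * F' + C` almost surely, then the same holds for the expectations. -/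
theorem PMF.tsum_mul_le {X : Type*} (p : PMF X) (F F' : X → ℝ≥0∞) (A C : ℝ≥0∞)
    (h : ∀ x ∈ p.support, F x ≤ A * F' x + C) :
    ∑' x, p x * F x ≤ A * ∑' x, p x * F' x + C := by
  calc ∑' x, p x * F x ≤ ∑' x, (A * (p x * F' x) + p x * C) := by
        refine ENNReal.tsum_le_tsum fun x => ?_
        by_cases hx : p x = 0
        · simp [hx]
        · calc p x * F x ≤ p x * (A * F' x + C) := by
                gcongr
                exact h x ((p.mem_support_iff x).2 hx)
            _ = _ := by ring
    _ = _ := by rw [ENNReal.tsum_add, ENNReal.tsum_mul_left, ENNReal.tsum_mul_right, p.tsum_coe,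
                  one_mul]

namespace MarkovChain

theorem trajectory_push {G H : Type*} (f : G ≃ H) (z : MarkovChain G) (n : ℕ) (o : G) :
    (z.push f).trajectory n (f o) = (z.trajectory n o).map (Equiv.listEquivOfEquiv f) := by
  induction n generalizing o with
  | zero => simp only [trajectory, PMF.pure_map]; rfl
  | succ n ih =>
    simp only [trajectory, push, Equiv.symm_apply_apply, PMF.bind_map, PMF.map_bind]
    congr 1
    funext g
    simp only [Function.comp_apply, ih, PMF.map_comp]
    rfl

theorem IsTame.push {ι κ G H : Type*} [Finite ι] [Group G] [Group H] {a : ι → G} {b : κ → H}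
    {f : G ≃ H} {M : ℕ} (ha : Generates a)
    (hM : ∀ x y, wordDist b (f x) (f y) ≤ M * wordDist a x y + M ∧
      wordDist a x y ≤ M * wordDist b (f x) (f y) + M)
    {z : MarkovChain G} (hz : z.IsTame a) : (z.push f).IsTame b := by
  obtain ⟨⟨K, hK0, hK⟩, ⟨A, ρ, hA, hρ, hz2⟩, hz3⟩ := hz
  refine ⟨⟨M * K + M + 1, Nat.succ_pos _, fun h h' hh => ?_⟩, ⟨A, ρ, hA, hρ, fun h h' n => ?_⟩,
    fun s => ?_⟩
  · obtain ⟨x, rfl⟩ := f.surjective h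
    obtain ⟨y, rfl⟩ := f.surjective h'
    rw [MarkovChain.push, PMF.map_equiv_apply, f.symm_apply_apply] at hh
    have h1 := (hM x y).1
    have h2 : M * wordDist a x y ≤ M * K := Nat.mul_le_mul_left _ (hK x y hh)
    omega
  · obtain ⟨x, rfl⟩ := f.surjective h
    rw [law_push]
    exact hz2 _ _ _
  · choose ε K hε hK hk using hz3
    -- The displacement in `G` matching a step by `s` in `H` varies with the starting point but
    -- stays in this ball; finiteness gives uniform constants.
    have hfin := ha.finite_ball (M * wordDist b 1 s + M)
    have hne : hfin.toFinset.Nonempty :=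
      ⟨1, by rw [Set.Finite.mem_toFinset, Set.mem_ofPred_eq, wordDist_self]; exact Nat.zero_le _⟩
    obtain ⟨t₀, -, ht₀⟩ := Finset.exists_min_image _ ε hne
    refine ⟨ε t₀, hfin.toFinset.sup K + 1, hε t₀, Nat.succ_pos _, fun h => ?_⟩
    obtain ⟨x, rfl⟩ := f.surjective h
    have ht : x⁻¹ * f.symm (f x * s) ∈ hfin.toFinset := by
      rw [Set.Finite.mem_toFinset, Set.mem_ofPred_eq, wordDist_one_inv_mul]
      have h1 := (hM x (f.symm (f x * s))).2
      rwa [f.apply_symm_apply, ← wordDist_one_inv_mul (f x), inv_mul_cancel_left] at h1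
    obtain ⟨k, hkK, hkε⟩ := hk (x⁻¹ * f.symm (f x * s)) x
    refine ⟨k, ?_, ?_⟩
    · have := Finset.le_sup (f := K) ht
      omega
    · rw [law_push]
      rw [mul_inv_cancel_left] at hkε
      exact (ht₀ _ ht).trans hkε

end MarkovChain

/-! ### The random Dehn function -/

section RandomDehn

theorem randomDehn_push {κ G H : Type*} [Group H] {b : κ → H} (R' : Set (FreeGroup κ)) (f : G ≃ H) (z : MarkovChain G)
    (β : GrpCombing b) (n : ℕ) : randomDehn R' (z.push f) β n =
      ⨆ o : G, ∑' l : List G,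
        z.trajectory n o l * (area R' (β.loopWord (f o) (l.map f)) : ℝ≥0∞) := by
  rw [randomDehn, ← f.surjective.iSup_comp]
  refine iSup_congr fun o => ?_
  rw [MarkovChain.trajectory_push, PMF.tsum_map_equiv]
  rfl

variable {ι κ G H : Type*} [Group G] [Group H] {a : ι → G} {b : κ → H}

/-- Along the trajectories of a chain with bounded jumps, the length of the loop grows at most
linearly in the number of steps. -/
theorem exists_length_loopWord_le (ha : Generates a) {z : MarkovChain G} (hz : z.IsTame a)
    {α : GrpCombing a} (hα : α.IsQuasiGeodesic) :
    ∃ P Q : ℕ, ∀ (n : ℕ) (o : G), ∀ l ∈ (z.trajectory n o).support,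
      (α.loopWord o l).length ≤ P * n + Q := by
  obtain ⟨K, -, hK⟩ := hz.1
  obtain ⟨c, hc⟩ := hα.exists_length_le
  -- The distance to the end point is tracked as well, since it controls the closing combing line.
  have key : ∀ (n : ℕ) (o : G), ∀ l ∈ (z.trajectory n o).support,
      (α.chainWord o l).length ≤ n * (c * K + c) ∧ wordDist a o (l.getLastD o) ≤ n * K := by
    intro n
    induction n with
    | zero =>
      intro o l hl
      rw [MarkovChain.trajectory, PMF.mem_support_pure_iff] at hl
      subst hl
      simp [GrpCombing.chainWord, wordDist_self]
    | succ n ih =>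
      intro o l hl
      rw [MarkovChain.trajectory, PMF.mem_support_bind_iff] at hl
      obtain ⟨g, hg, hl⟩ := hl
      obtain ⟨l, hl', rfl⟩ := (PMF.mem_support_map_iff _ _ _).1 hl
      obtain ⟨h1, h2⟩ := ih g l hl'
      have h3 := hK o g ((PMF.mem_support_iff _ _).1 hg)
      have h4 : c * wordDist a o g ≤ c * K := Nat.mul_le_mul_left _ h3
      have h5 := hc o g
      have h6 := ha.wordDist_triangle o g (l.getLastD g)
      rw [GrpCombing.chainWord, List.length_append, List.getLastD_cons, add_mul, add_mul, one_mul,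
        one_mul]
      omega
  refine ⟨(c * K + c) + c * K, c, fun n o l hl => ?_⟩
  obtain ⟨h1, h2⟩ := key n o l hl
  have h3 := hc o (l.getLastD o)
  have h4 : c * wordDist a o (l.getLastD o) ≤ c * (n * K) := Nat.mul_le_mul_left _ h2
  have h5 : ((c * K + c) + c * K) * n = n * (c * K + c) + c * (n * K) := by ring
  rw [GrpCombing.loopWord, List.length_append, FreeGroup.invRev_length]
  omega

/-- For fixed `n` the possible loops have bounded length, hence area bounded uniformly in the
starting point. -/
theorem randomDehn_ne_top [Finite ι] {R : Set (FreeGroup ι)} (hP : IsFinitePresentation a R)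
    {z : MarkovChain G} (hz : z.IsTame a) {α : GrpCombing a} (hα : α.IsQuasiGeodesic) (n : ℕ) :
    randomDehn R z α n ≠ ∞ := by
  obtain ⟨P, Q, hPQ⟩ := exists_length_loopWord_le hP.2.1 hz hα
  obtain ⟨A, hA⟩ := hP.exists_area_bound (P * n + Q)
  refine ne_top_of_le_ne_top (ENNReal.natCast_ne_top A) (iSup_le fun o => ?_)
  refine (PMF.tsum_mul_le (z.trajectory n o) _ (fun _ => 0) 0 A fun l hl => ?_).trans (by simp)
  rw [zero_mul, zero_add]
  exact_mod_cast (hA _ (hPQ n o l hl) (GrpCombing.eval_loopWord α o l)).area_le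

theorem asympEquiv_randomDehn_push [Finite ι] [Finite κ] {R : Set (FreeGroup ι)}
    {R' : Set (FreeGroup κ)} (hP : IsFinitePresentation a R) (hP' : IsFinitePresentation b R')
    {z : MarkovChain G} (hz : z.IsTame a) {α : GrpCombing a} (hα : α.IsQuasiGeodesic)
    (f : G ≃ H) {M M' : ℕ} {u : GrpCombing b} {v : GrpCombing a}
    (hu : ∀ x y, u.word y x = FreeGroup.invRev (u.word x y))
    (hv : ∀ x y, v.word y x = FreeGroup.invRev (v.word x y))
    (hM : BoundsEdges a f u M) (hM' : BoundsEdges b f.symm v M') :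
    AsympEquiv (randomDehn R z α) (randomDehn R' (z.push f) (pushCombing f α u)) := by
  obtain ⟨A, hA⟩ := exists_area_loopWord_comparison hP hP' f α hu hv hM hM'
  obtain ⟨P, Q, hPQ⟩ := exists_length_loopWord_le hP.2.1 hz hα
  constructor
  -- The factor `A + 1` is positive even if `A = 0`; the linear terms are the round-trip cost `A *
  -- (P * n + Q)`.
  · refine ⟨A + 1, A * P, A * Q, 1, 0, by positivity, one_pos, fun n => ?_⟩
    rw [randomDehn_push, one_mul, add_zero]
    refine iSup_le fun o => ?_
    refine (PMF.tsum_mul_le (z.trajectory n o) _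
      (fun l => (area R' ((pushCombing f α u).loopWord (f o) (l.map f)) : ℝ≥0∞))
      (A + 1 : ℕ) (A * P * n + A * Q : ℕ) fun l hl => ?_).trans ?_
    · have h1 := (hA o l).2
      have h2 : A * (α.loopWord o l).length ≤ A * (P * n + Q) :=
        Nat.mul_le_mul_left _ (hPQ n o l hl)
      have h3 : area R (α.loopWord o l) ≤
          (A + 1) * area R' ((pushCombing f α u).loopWord (f o) (l.map f)) +
            (A * P * n + A * Q) := by nlinarith
      exact_mod_cast h3
    · push_cast
      rw [← add_assoc]
      refine add_le_add_left (add_le_add_left (mul_le_mul_right ?_ _) _) _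
      exact le_iSup (fun o => ∑' l : List G, z.trajectory n o l *
        (area R' ((pushCombing f α u).loopWord (f o) (l.map f)) : ℝ≥0∞)) o
  · refine ⟨A + 1, 0, 0, 1, 0, by positivity, one_pos, fun n => ?_⟩
    rw [randomDehn_push, one_mul, add_zero]
    refine iSup_le fun o => ?_
    refine (PMF.tsum_mul_le (z.trajectory n o) _
      (fun l => (area R (α.loopWord o l) : ℝ≥0∞)) (A + 1 : ℕ) 0 fun l _ => ?_).trans ?_
    · rw [add_zero]
      have h1 := (hA o l).1
      have h3 : area R' ((pushCombing f α u).loopWord (f o) (l.map f)) ≤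
          (A + 1) * area R (α.loopWord o l) := by nlinarith
      exact_mod_cast h3
    · push_cast
      rw [zero_mul, add_zero, add_zero, add_zero]
      refine mul_le_mul_right ?_ _
      exact le_iSup (fun o => ∑' l : List G, z.trajectory n o l *
        (area R (α.loopWord o l) : ℝ≥0∞)) o

end RandomDehn

theorem proposition2 {G H ι κ : Type*} [Group G] [Group H] [Finite ι] [Finite κ]
    (hG : ¬ IsAmenableGroup G) (hH : ¬ IsAmenableGroup H)
    (a : ι → G) (R : Set (FreeGroup ι)) (hP : IsFinitePresentation a R)
    (b : κ → H) (hb : Generates b)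
    (hGH : ∃ q : G → H, IsQuasiIsometry a b q)
    (z : MarkovChain G) (hz : z.IsTame a)
    (α : GrpCombing a) (hα : α.IsQuasiGeodesic) :
    (∃ R' : Set (FreeGroup κ), IsFinitePresentation b R') ∧
    (∀ n : ℕ, randomDehn R z α n ≠ ∞) ∧
    ∃ (f : G ≃ H) (w : MarkovChain H) (β : GrpCombing b),
      IsQuasiIsometry a b f ∧
      w = z.push f ∧ w.IsTame b ∧
      GrpCombing.IsPushForward f α β ∧ β.IsQuasiGeodesic ∧
      ∀ R' : Set (FreeGroup κ), IsFinitePresentation b R' →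
        (∀ n : ℕ, randomDehn R' w β n ≠ ∞) ∧
        AsympEquiv (randomDehn R z α) (randomDehn R' w β) := by
  obtain ⟨q, hq⟩ := hGH
  obtain ⟨f, M, hf⟩ := exists_equiv_of_isQuasiIsometry hG hH hP.2.1 hb hq
  obtain ⟨u, hul, hu⟩ := hb.exists_symmetric_geodesics
  obtain ⟨v, hvl, hv⟩ := hP.2.1.exists_symmetric_geodesics
  have hM : BoundsEdges a f u (M + M) := boundsEdges_of_lipschitz (fun x y => (hf x y).1) hul
  have hM' : BoundsEdges b f.symm v (M + M) := boundsEdges_of_lipschitz (fun x y => by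
    simpa using (hf (f.symm x) (f.symm y)).2) hvl
  have hw : (z.push f).IsTame b := hz.push hP.2.1 hf
  have hβ : (pushCombing f α u).IsQuasiGeodesic :=
    isQuasiGeodesic_pushCombing hb hα hM fun x y => (hf x y).2
  exact ⟨exists_isFinitePresentation_of_equiv hP hb f hu hM hM', randomDehn_ne_top hP hz hα,
    f, z.push f, pushCombing f α u, isQuasiIsometry_of_nat_bound hf, rfl, hw,
    ⟨u, hul, fun _ _ => rfl⟩, hβ, fun R' hP' => ⟨randomDehn_ne_top hP' hw hβ,
      asympEquiv_randomDehn_push hP hP' hz hα f hu hv hM hM'⟩⟩
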